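/- For $x\in\mathbb{Q}$ and $k\ge 0$ let $(x)_k=x(x+1)\cdots(x+k-1)$ (with $(x)_0=1$). For a prime $p$ let $\Gamma_p:\mathbb{Z}_p\to\mathbb{Z}_p$ denote Morita's $p$-adic Gamma function, $\Gamma_p(x)=\lim_{n\to x}(-1)^n\prod_{0<k<n,\;p\nmid k}k$, where $n$ runs over natural numbers tending $p$-adically to $x$. For $a,b\in\mathbb{Q}_p$, $a\equiv b\pmod{p^2}$ means $a-b\in p^2\mathbb{Z}_p$. (i) Let $d,r$ be positive integers with $d\ge 3+r$ and $\gcd(d,r)=1$. Then for every prime $p\ge 2d-r$ with $p\equiv -r\pmod d$, the number $-\tfrac rd$ lies in $\mathbb{Z}_p$ and $$\sum_{k=0}^{p-1}\frac{\left(\frac{d+r}{d}\right)_k^{d-r}\left(\frac rd\right)_k^{r-1}\left(\frac{r-d}{d}\right)_k}{k!^d}\equiv \frac{d-r}{d}\left(\frac rd\right)^r\Gamma_p\left(-\frac rd\right)^d\pmod{p^2}.$$ (ii) Let $d,r$ be positive integers with $d>r$ and $\gcd(d,r)=1$. Then for every prime $p\ge 5$ with $p\equiv -r\pmod d$, the number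 $-\tfrac rd$ lies in $\mathbb{Z}_p$ and $$\sum_{k=0}^{p-1}\frac{\left(\frac{d+r}{d}\right)_k^{d-r-1}\left(\frac rd\right)_k^{r+1}}{k!^d}\equiv -\left(\frac rd\right)^{r+1}\Gamma_p\left(-\frac rd\right)^d\pmod{p^2}.$$ -/

import Mathlib

/-- The values `Γ_p(n) = (-1)^n ∏_{0 < k < n, p ∤ k} k` at natural numbers `n`
(the index `k = 0` is excluded by `p ∤ k`). -/
def padicGammaNat (p n : ℕ) : ℤ :=
  (-1) ^ n * ∏ k ∈ (Finset.range n).filter (fun k => ¬ p ∣ k), (k : ℤ)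

/-- Morita's `p`-adic Gamma function `Γ_p : ℤ_p → ℤ_p`,
`Γ_p(x) = lim (-1)^n ∏_{0 < k < n, p ∤ k} k`, the limit being over natural numbers `n` tending
`p`-adically to `x`. -/
noncomputable def padicGamma (p : ℕ) [Fact p.Prime] (x : ℤ_[p]) : ℤ_[p] :=
  Filter.limUnder (Filter.comap (fun n : ℕ => (n : ℤ_[p])) (nhds x))
    (fun n : ℕ => (padicGammaNat p n : ℤ_[p]))

/-- The Pochhammer symbol `(x)_k = x (x + 1) ⋯ (x + k - 1)` of a rational number. -/
noncomputable def poch (x : ℚ) (k : ℕ) : ℚ := (ascPochhammer ℚ k).eval x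

/-- The congruence `a ≡ b (mod p^m)`, that is, `a - b ∈ p^m ℤ_p`. -/
def PadicModEq (p : ℕ) [Fact p.Prime] (m : ℕ) (a b : ℚ_[p]) : Prop :=
  ∃ z : ℤ_[p], a - b = (p : ℚ_[p]) ^ m * (z : ℚ_[p])

/-! Write `p + r = d M`, so `r/d = M - p/d`, and put `F(n, y) = ∏_{l=1}^n (l - y)`. Since `F(n + k,
y) = F(n, y) (n + 1 - y)_k`, multiplying the sum by `∏ F(n_i, p/d)` turns its terms into `∏ F(n_i +
k, p/d) / k!^d`, for `d` indices `n_i` (equal to `M`, `M - 1`, or once `M - 2` in (i)) whose sum is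
`p - 1`.

Modulo `p ^ 2`, moving all `d` factors by `p/d` is the average of moving a single factor by `p`
(`prod_shiftedFactorial_eq_average`). With only factor `i` moved, the sum is exact: that factor is a
constant times `(-1)^k k! C(p-1-n_i, k)`, the others divided by `k!` are monic polynomials in `k` of
total degree `p - 1 - n_i`, and a top-order finite difference gives `(p-1)!` for every `i`
(`sum_shiftedFactorial_mul_prod_factorial`).

On the other side, `Γ_p(p/d - M) F(M, p/d) = Γ_p(p/d)`, and `Γ_p(p/d)^d ≡ -(p-1)!`
(`padicGamma_pow_mul_shiftedFactorial_pow`). Comparing and cancelling the unit `∏ F(n_i, p/d)`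
leaves the stated power of `r/d`. -/

/-- The product `∏_{l=1}^n (l - y)`. -/
def shiftedFactorial {R : Type*} [CommRing R] (n : ℕ) (y : R) : R :=
  ∏ l ∈ Finset.range n, ((l : R) + 1 - y)

/-! ### Shifted factorials and their first-order expansion -/

section ShiftedFactorial

variable {R : Type*} [CommRing R]

lemma shiftedFactorial_succ (n : ℕ) (y : R) :
    shiftedFactorial (n + 1) y = shiftedFactorial n y * ((n : R) + 1 - y) :=
  Finset.prod_range_succ _ _

lemma shiftedFactorial_zero_right (n : ℕ) : shiftedFactorial n (0 : R) = (n.factorial : R) := by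
  simp [shiftedFactorial, ← Finset.prod_range_add_one_eq_factorial]

lemma shiftedFactorial_add (n k : ℕ) (y : R) :
    shiftedFactorial (n + k) y =
      shiftedFactorial n y * (ascPochhammer R k).eval ((n : R) + 1 - y) := by
  induction k with
  | zero => simp
  | succ k ih =>
    rw [← add_assoc, shiftedFactorial_succ, ih, ascPochhammer_succ_eval]
    push_cast
    ring

/-- For `n > q` both sides vanish; this truncates the sum over `k` when one factor is moved by `p =
q + 1`. -/
lemma shiftedFactorial_natCast (n q : ℕ) :
    shiftedFactorial n ((q + 1 : ℕ) : R) = (-1) ^ n * (q.descFactorial n : R) := by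
  induction n with
  | zero => simp [shiftedFactorial]
  | succ n ih =>
    rw [shiftedFactorial_succ, ih, Nat.descFactorial_succ]
    rcases le_or_gt n q with h | h
    · push_cast [Nat.cast_sub h]
      ring
    · simp [Nat.descFactorial_eq_zero_iff_lt.2 h]

/-- First-order expansion of `shiftedFactorial` along an element of square zero. -/
lemma exists_shiftedFactorial_eq {π : R} (hπ : π ^ 2 = 0) (n : ℕ) :
    ∃ c : R, ∀ t : R, shiftedFactorial n (π * t) = shiftedFactorial n 0 + π * t * c := by
  induction n with
  | zero => exact ⟨0, fun t => by simp [shiftedFactorial]⟩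
  | succ n ih =>
    obtain ⟨c, hc⟩ := ih
    refine ⟨c * (n + 1) - shiftedFactorial n 0, fun t => ?_⟩
    rw [shiftedFactorial_succ, shiftedFactorial_succ, hc]
    linear_combination (-t ^ 2 * c) * hπ

lemma prod_add_mul_of_sq_eq_zero {ι : Type*} [DecidableEq ι] {ε : R} (hε : ε ^ 2 = 0)
    (s : Finset ι) (b c : ι → R) :
    ∏ i ∈ s, (b i + ε * c i) = ∏ i ∈ s, b i + ε * ∑ i ∈ s, c i * ∏ j ∈ s.erase i, b j := by
  induction s using Finset.induction_on with
  | empty => simp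
  | insert a s ha ih =>
    have h : ∑ i ∈ s, c i * ∏ j ∈ (insert a s).erase i, b j =
        b a * ∑ i ∈ s, c i * ∏ j ∈ s.erase i, b j := by
      rw [Finset.mul_sum]
      refine Finset.sum_congr rfl fun i hi => ?_
      have hne : a ≠ i := fun h => ha (h ▸ hi)
      rw [Finset.erase_insert_of_ne hne,
        Finset.prod_insert fun h => ha (Finset.mem_of_mem_erase h)]
      ring
    rw [Finset.prod_insert ha, ih, Finset.prod_insert ha, Finset.sum_insert ha,
      Finset.erase_insert ha, h]
    linear_combination (c a * ∑ i ∈ s, c i * ∏ j ∈ s.erase i, b j) * hε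

/-- To first order, moving all factors by `π u` with `u = 1 / card ι` is the average of moving
one factor by `π`. -/
lemma prod_shiftedFactorial_eq_average {ι : Type*} [Fintype ι] [DecidableEq ι] {π u : R}
    (hπ : π ^ 2 = 0) (hu : (Fintype.card ι : R) * u = 1) (n : ι → ℕ) :
    ∏ i, shiftedFactorial (n i) (π * u) =
      u * ∑ i, shiftedFactorial (n i) π * ∏ j ∈ Finset.univ.erase i, ((n j).factorial : R) := by
  choose c hc using fun i => exists_shiftedFactorial_eq hπ (n i)
  have hε : (π * u) ^ 2 = 0 := by rw [mul_pow, hπ, zero_mul]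
  have h1 : ∀ i, shiftedFactorial (n i) π = (n i).factorial + π * c i := fun i => by
    simpa [shiftedFactorial_zero_right] using hc i 1
  have h2 : ∀ i, (n i).factorial * ∏ j ∈ Finset.univ.erase i, ((n j).factorial : R) =
      ∏ j, ((n j).factorial : R) := fun i =>
    Finset.mul_prod_erase Finset.univ (fun j => ((n j).factorial : R)) (Finset.mem_univ i)
  simp_rw [hc, shiftedFactorial_zero_right, prod_add_mul_of_sq_eq_zero hε, h1, add_mul, h2,
    Finset.sum_add_distrib, mul_assoc π (c _), ← Finset.mul_sum]
  rw [Finset.sum_const, Finset.card_univ, nsmul_eq_mul]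
  linear_combination -(∏ j, ((n j).factorial : R)) * hu

end ShiftedFactorial

/-! ### Exact evaluation by finite differences -/

/-- The alternating binomial sum of a monic polynomial of degree `N`. -/
lemma sum_neg_one_pow_mul_choose_mul_eval_of_monic {P : Polynomial ℤ} (hP : P.Monic) {p : ℕ}
    (hp : P.natDegree < p) :
    ∑ k ∈ Finset.range p, (-1) ^ k * (P.natDegree.choose k : ℤ) * P.eval (k : ℤ) =
      (-1) ^ P.natDegree * (P.natDegree.factorial : ℤ) := by
  have h := congrFun P.fwdDiff_iter_degree_eq_factorial 0
  rw [fwdDiff_iter_eq_sum_shift, hP.leadingCoeff] at h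
  simp only [smul_eq_mul, nsmul_eq_mul, mul_one, zero_add, one_smul] at h
  rw [← Finset.sum_subset (Finset.range_mono (Nat.succ_le_of_lt hp))]
  · have h' : ∑ k ∈ Finset.range (P.natDegree + 1),
        (-1) ^ (P.natDegree - k) * (P.natDegree.choose k : ℤ) * P.eval (k : ℤ) =
          (P.natDegree.factorial : ℤ) := h
    rw [← h', Finset.mul_sum]
    refine Finset.sum_congr rfl fun k hk => ?_
    have hk' : k ≤ P.natDegree := Nat.lt_succ_iff.1 (Finset.mem_range.1 hk)
    have : (-1 : ℤ) ^ P.natDegree * (-1) ^ (P.natDegree - k) = (-1) ^ k := by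
      rw [← pow_add, show P.natDegree + (P.natDegree - k) = k + 2 * (P.natDegree - k) by omega,
        pow_add, pow_mul]
      simp
    rw [← this]
    ring
  · intro k _ hk
    rw [Nat.choose_eq_zero_of_lt (by simpa using hk)]
    simp

lemma factorial_add_eq_eval (n k : ℕ) :
    (((n + k).factorial : ℕ) : ℤ) =
      k.factorial * ((ascPochhammer ℤ n).comp (Polynomial.X + Polynomial.C 1)).eval (k : ℤ) := by
  rw [add_comm, ← Nat.factorial_mul_ascFactorial, Nat.cast_mul,
    ← ascPochhammer_nat_eq_natCast_ascFactorial]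
  simp

/-- The exact evaluation behind the congruences: only one factor is moved. -/
lemma sum_shiftedFactorial_mul_prod_factorial {R : Type*} [CommRing R] {ι : Type*} [Fintype ι]
    [DecidableEq ι] {q : ℕ} (hq : Even q) (v : ℕ → R)
    (hv : ∀ k ≤ q, v k * (k.factorial : R) = 1) (n : ι → ℕ) (hn : ∑ i, n i = q) (i : ι) :
    ∑ k ∈ Finset.range (q + 1), v k ^ Fintype.card ι *
      (shiftedFactorial (n i + k) ((q + 1 : ℕ) : R) *
        ∏ j ∈ Finset.univ.erase i, ((n j + k).factorial : R)) = (q.factorial : R) := by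
  set P : Polynomial ℤ := ∏ j ∈ Finset.univ.erase i,
    (ascPochhammer ℤ (n j)).comp (Polynomial.X + Polynomial.C 1) with hP
  have hmonic : ∀ j, ((ascPochhammer ℤ (n j)).comp (Polynomial.X + Polynomial.C 1)).Monic :=
    fun j => (monic_ascPochhammer ℤ (n j)).comp_X_add_C 1
  have hPm : P.Monic := Polynomial.monic_prod_of_monic _ _ fun j _ => hmonic j
  have hsum : n i + ∑ j ∈ Finset.univ.erase i, n j = q := by
    rw [Finset.add_sum_erase _ _ (Finset.mem_univ i), hn]
  have hdeg : P.natDegree = q - n i := by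
    rw [hP, Polynomial.natDegree_prod_of_monic _ _ fun j _ => hmonic j]
    simp only [Polynomial.natDegree_comp, ascPochhammer_natDegree, Polynomial.natDegree_X_add_C,
      mul_one]
    omega
  have hle : n i ≤ q := by omega
  have hterm : ∀ k ∈ Finset.range (q + 1), v k ^ Fintype.card ι *
      (shiftedFactorial (n i + k) ((q + 1 : ℕ) : R) *
        ∏ j ∈ Finset.univ.erase i, ((n j + k).factorial : R)) =
      (-1) ^ n i * (q.descFactorial (n i) : R) *
        (((-1) ^ k * (P.natDegree.choose k : ℤ) * P.eval (k : ℤ) : ℤ) : R) := by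
    intro k hk
    have hvk := hv k (Nat.lt_succ_iff.1 (Finset.mem_range.1 hk))
    have hprod : ∏ j ∈ Finset.univ.erase i, ((n j + k).factorial : R) =
        (k.factorial : R) ^ (Fintype.card ι - 1) * ((P.eval (k : ℤ) : ℤ) : R) := by
      rw [hP, Polynomial.eval_prod, Int.cast_prod, ← Finset.card_univ,
        ← Finset.card_erase_of_mem (Finset.mem_univ i), ← Finset.prod_const,
        ← Finset.prod_mul_distrib]
      refine Finset.prod_congr rfl fun j _ => ?_
      exact_mod_cast congrArg (Int.cast : ℤ → R) (factorial_add_eq_eval (n j) k)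
    -- The moved factor supplies the binomial coefficient; its `k!` cancels the one copy of `v k`
    -- that the other factors leave over.
    have hdesc : q.descFactorial (n i + k) =
        q.descFactorial (n i) * (k.factorial * P.natDegree.choose k) := by
      rw [hdeg, ← Nat.descFactorial_eq_factorial_mul_choose,
        ← Nat.descFactorial_mul_descFactorial (Nat.le_add_right (n i) k), Nat.add_sub_cancel_left,
        mul_comm]
    have hcard : Fintype.card ι = Fintype.card ι - 1 + 1 :=
      (Nat.sub_add_cancel (Fintype.card_pos_iff.2 ⟨i⟩)).symm
    have hpow : v k ^ Fintype.card ι * (k.factorial : R) ^ (Fintype.card ι - 1) * k.factorial = 1 := by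
      rw [mul_assoc, ← pow_succ, ← hcard, ← mul_pow, hvk, one_pow]
    rw [shiftedFactorial_natCast, hprod, hdesc]
    push_cast
    linear_combination ((-1) ^ (n i + k) * (q.descFactorial (n i) : R) *
      (P.natDegree.choose k : R) * ((P.eval (k : ℤ) : ℤ) : R)) * hpow
  rw [Finset.sum_congr rfl hterm, ← Finset.mul_sum, ← Int.cast_sum,
    sum_neg_one_pow_mul_choose_mul_eval_of_monic hPm (by omega), hdeg,
    ← Nat.factorial_mul_descFactorial hle]
  -- The two signs combine to `(-1) ^ q`, so evenness of `q` makes the value independent of `i`.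
  have hsign : (-1 : R) ^ n i * (-1) ^ (q - n i) = 1 := by
    rw [← pow_add, Nat.add_sub_cancel' hle, hq.neg_one_pow]
  push_cast
  linear_combination ((q - n i).factorial * q.descFactorial (n i) : R) * hsign

/-- In a ring where `p ^ 2 = 0`, with `p` odd, a sum of products of `d` shifted factorials,
all moved by `p / d`. -/
lemma sum_prod_shiftedFactorial {R : Type*} [CommRing R] {ι : Type*} [Fintype ι] {q : ℕ}
    (hq : Even q) (hπ : ((q + 1 : ℕ) : R) ^ 2 = 0) {u : R} (hu : (Fintype.card ι : R) * u = 1)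
    (v : ℕ → R) (hv : ∀ k ≤ q, v k * (k.factorial : R) = 1) (n : ι → ℕ) (hn : ∑ i, n i = q) :
    ∑ k ∈ Finset.range (q + 1), v k ^ Fintype.card ι *
      ∏ i, shiftedFactorial (n i + k) (((q + 1 : ℕ) : R) * u) = (q.factorial : R) := by
  classical
  simp_rw [prod_shiftedFactorial_eq_average hπ hu fun i => n i + _, Finset.mul_sum,
    mul_left_comm _ u]
  rw [Finset.sum_comm]
  simp_rw [← Finset.mul_sum]
  simp_rw [sum_shiftedFactorial_mul_prod_factorial hq v hv n hn]
  rw [Finset.sum_const, Finset.card_univ, nsmul_eq_mul]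
  linear_combination (q.factorial : R) * hu

/-! ### Continuity of `Γ_p` and its values at natural numbers -/

lemma padicGammaNat_succ_of_not_dvd {p n : ℕ} (h : ¬ p ∣ n) :
    padicGammaNat p (n + 1) = -(n : ℤ) * padicGammaNat p n := by
  rw [padicGammaNat, padicGammaNat, Finset.range_add_one, Finset.filter_insert, if_pos h,
    Finset.prod_insert (by simp)]
  ring

lemma padicGammaNat_succ_of_dvd {p n : ℕ} (h : p ∣ n) :
    padicGammaNat p (n + 1) = -padicGammaNat p n := by
  rw [padicGammaNat, padicGammaNat, Finset.range_add_one, Finset.filter_insert,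
    if_neg (not_not.2 h)]
  ring

/-- Wilson's theorem modulo a power of an odd prime. -/
lemma prod_units_zmod_prime_pow {p : ℕ} [Fact p.Prime] (hp : Odd p) (N : ℕ) :
    ∏ u : (ZMod (p ^ (N + 1)))ˣ, u = -1 := by
  classical
  have hpp : p.Prime := Fact.out
  have hlt : 2 < p ^ (N + 1) := by
    have h2 : 2 < p := by
      have := hpp.two_le
      obtain ⟨k, hk⟩ := hp
      omega
    exact h2.trans_le (Nat.le_self_pow N.succ_ne_zero p)
  have : Fact (2 < p ^ (N + 1)) := ⟨hlt⟩
  have hsq : ∀ u : (ZMod (p ^ (N + 1)))ˣ, u * u = 1 → u = 1 ∨ u = -1 := by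
    intro u hu
    have h0 : ((u : ZMod (p ^ (N + 1))) - 1) * (u + 1) = 0 := by
      have := congrArg Units.val hu
      push_cast at this
      linear_combination this
    obtain ⟨a, ha⟩ := ZMod.intCast_surjective (u : ZMod (p ^ (N + 1)))
    rw [← ha] at h0
    have hdvd : ((p : ℤ) ^ (N + 1)) ∣ (a - 1) * (a + 1) := by
      have := (ZMod.intCast_zmod_eq_zero_iff_dvd ((a - 1) * (a + 1)) (p ^ (N + 1))).1
        (by push_cast; exact h0)
      simpa using this
    have hpi : Prime (p : ℤ) := Nat.prime_iff_prime_int.1 hpp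
    -- An odd `p` cannot divide both `a - 1` and `a + 1`, so the full prime power divides one of
    -- them.
    by_cases h : (p : ℤ) ∣ a - 1
    · have h' : ¬ (p : ℤ) ∣ a + 1 := by
        intro h'
        have h2 : (p : ℤ) ∣ 2 := by
          have := dvd_sub h' h
          ring_nf at this
          exact this
        have : p ∣ 2 := by exact_mod_cast h2
        have := (Nat.prime_dvd_prime_iff_eq hpp Nat.prime_two).1 this
        subst this
        exact absurd hp (by decide)
      left
      have := hpi.pow_dvd_of_dvd_mul_right _ h' hdvd
      ext
      rw [← ha, Units.val_one, ← sub_eq_zero]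
      have := (ZMod.intCast_zmod_eq_zero_iff_dvd (a - 1) (p ^ (N + 1))).2 (by simpa using this)
      simpa using this
    · right
      have := hpi.pow_dvd_of_dvd_mul_left _ h hdvd
      ext
      rw [← ha, Units.val_neg, Units.val_one, ← sub_eq_zero]
      have := (ZMod.intCast_zmod_eq_zero_iff_dvd (a + 1) (p ^ (N + 1))).2 (by simpa using this)
      simpa using this
  have hne : (1 : (ZMod (p ^ (N + 1)))ˣ) ≠ -1 := by
    intro h
    exact ZMod.neg_one_ne_one (congrArg Units.val h).symm
  rw [← Finset.mul_prod_erase _ _ (Finset.mem_univ (1 : (ZMod (p ^ (N + 1)))ˣ)),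
    ← Finset.mul_prod_erase _ _ (Finset.mem_erase.2 ⟨hne.symm, Finset.mem_univ (-1)⟩)]
  -- All units other than `±1` cancel in pairs with their inverses.
  rw [Finset.prod_involution (fun u _ => u⁻¹)]
  · simp
  · simp
  · intro u hu _ h
    have := hsq u (by nth_rewrite 1 [← h]; simp)
    simp only [Finset.mem_erase, Finset.mem_univ, and_true] at hu
    tauto
  · intro u hu
    simp only [Finset.mem_erase, Finset.mem_univ, and_true, ne_eq, inv_eq_one] at hu ⊢
    exact ⟨fun h => hu.1 (by rw [← inv_inv u, h]; simp), hu.2⟩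
  · simp

/-- Wilson's `-1` meets the sign `(-1) ^ (p ^ (N + 1)) = -1`. This is the base case of periodicity
modulo `p ^ N`. -/
lemma padicGammaNat_prime_pow {p : ℕ} [Fact p.Prime] (hp : Odd p) (N : ℕ) :
    (padicGammaNat p (p ^ (N + 1)) : ZMod (p ^ (N + 1))) = 1 := by
  have h : ∏ k ∈ (Finset.range (p ^ (N + 1))).filter (fun k => ¬ p ∣ k),
      (k : ZMod (p ^ (N + 1))) = ((∏ u : (ZMod (p ^ (N + 1)))ˣ, u : (ZMod (p ^ (N + 1)))ˣ) :
        ZMod (p ^ (N + 1))) := by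
    have hpp : p.Prime := Fact.out
    have : NeZero (p ^ (N + 1)) := ⟨pow_ne_zero _ hpp.ne_zero⟩
    have hcop : ∀ k, k.Coprime (p ^ (N + 1)) ↔ ¬ p ∣ k := fun k => by
      rw [Nat.coprime_pow_right_iff N.succ_pos, Nat.coprime_comm, hpp.coprime_iff_not_dvd]
    rw [Units.coe_prod]
    symm
    refine Finset.prod_bij (fun u _ => (u : ZMod (p ^ (N + 1))).val) ?_ ?_ ?_ ?_
    · intro u _
      simp only [Finset.mem_filter, Finset.mem_range]
      exact ⟨ZMod.val_lt _, (hcop _).1 (ZMod.val_coe_unit_coprime u)⟩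
    · intro u _ w _ h
      exact Units.ext (ZMod.val_injective _ h)
    · intro k hk
      simp only [Finset.mem_filter, Finset.mem_range] at hk
      refine ⟨ZMod.unitOfCoprime k ((hcop k).2 hk.2), Finset.mem_univ _, ?_⟩
      simp [ZMod.val_natCast, Nat.mod_eq_of_lt hk.1]
    · intro u _
      simp
  rw [padicGammaNat, (hp.pow).neg_one_pow]
  push_cast
  rw [h, prod_units_zmod_prime_pow hp]
  simp

lemma padicGammaNat_add_prime_pow {p : ℕ} [Fact p.Prime] (hp : Odd p) (N n : ℕ) :
    (padicGammaNat p (n + p ^ N) : ZMod (p ^ N)) = padicGammaNat p n := by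
  rcases N with _ | N
  · have : Subsingleton (ZMod (p ^ 0)) := by rw [pow_zero]; infer_instance
    exact Subsingleton.elim _ _
  induction n with
  | zero =>
    rw [zero_add, padicGammaNat_prime_pow hp]
    simp [padicGammaNat]
  | succ n ih =>
    rw [add_right_comm]
    have hdvd : p ∣ n + p ^ (N + 1) ↔ p ∣ n :=
      (Nat.dvd_add_iff_left (dvd_pow_self p N.succ_ne_zero)).symm
    by_cases h : p ∣ n
    · rw [padicGammaNat_succ_of_dvd h, padicGammaNat_succ_of_dvd (hdvd.2 h), Int.cast_neg, ih,
        Int.cast_neg]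
    · rw [padicGammaNat_succ_of_not_dvd h, padicGammaNat_succ_of_not_dvd (mt hdvd.1 h),
        Int.cast_mul, ih]
      have h0 : ((p : ZMod (p ^ (N + 1))) ^ (N + 1)) = 0 := by
        exact_mod_cast ZMod.natCast_self (p ^ (N + 1))
      push_cast
      rw [h0, add_zero]

lemma padicGammaNat_congr {p : ℕ} [Fact p.Prime] (hp : Odd p) {N a b : ℕ}
    (hab : (a : ZMod (p ^ N)) = b) :
    (padicGammaNat p a : ZMod (p ^ N)) = padicGammaNat p b := by
  have key : ∀ n t : ℕ, (padicGammaNat p (n + p ^ N * t) : ZMod (p ^ N)) = padicGammaNat p n := by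
    intro n t
    induction t with
    | zero => simp
    | succ t ih => rw [mul_add, mul_one, ← add_assoc, padicGammaNat_add_prime_pow hp, ih]
  have h := (ZMod.natCast_eq_natCast_iff a b (p ^ N)).1 hab
  rw [← Nat.mod_add_div a (p ^ N), ← Nat.mod_add_div b (p ^ N), key, key]
  exact congrArg (fun c => (padicGammaNat p c : ZMod (p ^ N))) h

/-- For odd `p` the limit defining `Γ_p(x)` exists, and it is determined modulo `p ^ N` by
the value at any natural number congruent to `x`. -/
lemma toZModPow_padicGamma {p : ℕ} [Fact p.Prime] (hp : Odd p) (x : ℤ_[p]) {N n : ℕ}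
    (hn : PadicInt.toZModPow N x = (n : ZMod (p ^ N))) :
    PadicInt.toZModPow N (padicGamma p x) = (padicGammaNat p n : ZMod (p ^ N)) := by
  have happr : ∀ i, PadicInt.toZModPow i x = (x.appr i : ZMod (p ^ i)) := fun i => rfl
  have hdvd : ∀ i, (p : ℤ) ^ i ∣ padicGammaNat p (x.appr (i + 1)) - padicGammaNat p (x.appr i) := by
    intro i
    have h : ((x.appr i : ℕ) : ZMod (p ^ i)) = (x.appr (i + 1) : ℕ) := by
      rw [← happr, ← PadicInt.cast_toZModPow i (i + 1) i.le_succ, happr]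
      exact ZMod.cast_natCast (pow_dvd_pow p i.le_succ) _
    have := (ZMod.intCast_eq_intCast_iff_dvd_sub _ _ _).1 (padicGammaNat_congr hp h)
    simpa using this
  set L : ℤ_[p] := PadicInt.ofIntSeq _ (PadicInt.isCauSeq_padicNorm_of_pow_dvd_sub
    (fun i => padicGammaNat p (x.appr i)) p hdvd) with hL
  have hLN : ∀ i, PadicInt.toZModPow i L = (padicGammaNat p (x.appr i) : ZMod (p ^ i)) :=
    fun i => PadicInt.toZModPow_ofIntSeq_of_pow_dvd_sub _ p hdvd i
  have hball : ∀ (y z : ℤ_[p]) (i : ℕ), PadicInt.toZModPow i y = PadicInt.toZModPow i z ↔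
      dist y z ≤ (p : ℝ) ^ (-(i : ℤ)) := by
    intro y z i
    rw [dist_eq_norm, PadicInt.norm_le_pow_iff_mem_span_pow, ← PadicInt.ker_toZModPow,
      RingHom.mem_ker, map_sub, sub_eq_zero]
  -- Density of the naturals in `ℤ_p` makes the filter nontrivial, so that the limit is unique.
  have : (Filter.comap (fun n : ℕ => (n : ℤ_[p])) (nhds x)).NeBot :=
    Filter.comap_neBot_iff.2 fun t ht => by
      obtain ⟨_, hy, ⟨a, rfl⟩⟩ := mem_closure_iff_nhds.1 (PadicInt.denseRange_natCast x) t ht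
      exact ⟨a, hy⟩
  have hlim : Filter.Tendsto (fun n : ℕ => (padicGammaNat p n : ℤ_[p]))
      (Filter.comap (fun n : ℕ => (n : ℤ_[p])) (nhds x)) (nhds L) := by
    rw [Metric.tendsto_nhds]
    intro ε hε
    obtain ⟨i, hi⟩ := PadicInt.exists_pow_neg_lt p hε
    have hp0 : (0 : ℝ) < (p : ℝ) ^ (-(i : ℤ)) :=
      zpow_pos (by exact_mod_cast (Fact.out : p.Prime).pos) _
    refine Filter.mem_of_superset
      (Filter.preimage_mem_comap (Metric.closedBall_mem_nhds x hp0)) fun k hk => ?_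
    refine lt_of_le_of_lt ((hball _ _ i).1 ?_) hi
    have hk' := (hball _ _ i).2 (Metric.mem_closedBall.1 hk)
    rw [map_natCast, happr] at hk'
    rw [map_intCast, hLN]
    exact padicGammaNat_congr hp hk'
  rw [padicGamma, hlim.limUnder_eq, hLN]
  exact padicGammaNat_congr hp (by rw [← happr, hn])

/-! ### `Γ_p` near multiples of `p`, and the sum, modulo `p ^ 2` -/

lemma one_add_pow_of_sq_eq_zero {R : Type*} [CommRing R] {ε : R} (hε : ε ^ 2 = 0) (n : ℕ) :
    (1 + ε) ^ n = 1 + n * ε := by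
  induction n with
  | zero => simp
  | succ n ih =>
    rw [pow_succ, ih]
    push_cast
    linear_combination (n : R) * hε

lemma padicGammaNat_mul_add_one_add {p : ℕ} (e : ℕ) {j : ℕ} (hj : j < p) :
    padicGammaNat p (p * e + 1 + j) =
      -(-1) ^ j * padicGammaNat p (p * e) * shiftedFactorial j (-((p : ℤ) * e)) := by
  induction j with
  | zero => simp [padicGammaNat_succ_of_dvd, shiftedFactorial]
  | succ j ih =>
    have h : ¬ p ∣ p * e + 1 + j := fun h =>
      Nat.not_dvd_of_pos_of_lt j.succ_pos hj
        ((Nat.dvd_add_right (dvd_mul_right p e)).1 (by rwa [Nat.succ_eq_one_add, ← add_assoc]))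
    rw [← add_assoc, padicGammaNat_succ_of_not_dvd h, ih (by omega), shiftedFactorial_succ]
    push_cast
    ring

lemma padicGammaNat_sub_mul_shiftedFactorial {p e m : ℕ} (he : 0 < e) (hm : m < p) :
    padicGammaNat p (p * e - m) * shiftedFactorial m ((p : ℤ) * e) = padicGammaNat p (p * e) := by
  have hpe : p ≤ p * e := Nat.le_mul_of_pos_right p he
  induction m with
  | zero => simp [shiftedFactorial]
  | succ m ih =>
    have h : ¬ p ∣ p * e - (m + 1) := fun h =>
      Nat.not_dvd_of_pos_of_lt m.succ_pos hm
        ((Nat.dvd_sub_iff_right (hm.le.trans hpe) (dvd_mul_right p e)).1 h)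
    rw [← ih (by omega), show p * e - m = p * e - (m + 1) + 1 by omega,
      padicGammaNat_succ_of_not_dvd h, shiftedFactorial_succ, Nat.cast_sub (hm.le.trans hpe)]
    push_cast
    ring

section ModSq

variable {p : ℕ} [Fact p.Prime]

lemma natCast_prime_sq_eq_zero (p : ℕ) : (p : ZMod (p ^ 2)) ^ 2 = 0 := by
  exact_mod_cast ZMod.natCast_self (p ^ 2)

lemma intCast_shiftedFactorial {R : Type*} [CommRing R] (n : ℕ) (y : ℤ) :
    ((shiftedFactorial n y : ℤ) : R) = shiftedFactorial n (y : R) := by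
  simp [shiftedFactorial]

lemma even_pred_of_odd {p : ℕ} (hp : Odd p) : Even (p - 1) := by
  obtain ⟨k, rfl⟩ := hp
  exact ⟨k, by omega⟩

/-- The left side is affine in `t` modulo `p ^ 2`, and takes the same value at `t = 0` and at `t =
1`, where the product is reversed with `p - 1` signs. -/
lemma shiftedFactorial_pred_prime_mul (hp : Odd p) (t : ZMod (p ^ 2)) :
    shiftedFactorial (p - 1) ((p : ZMod (p ^ 2)) * t) = ((p - 1).factorial : ZMod (p ^ 2)) := by
  obtain ⟨c, hc⟩ := exists_shiftedFactorial_eq (natCast_prime_sq_eq_zero p) (p - 1)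
  have h1 := shiftedFactorial_natCast (R := ZMod (p ^ 2)) (p - 1) (p - 1)
  rw [Nat.sub_add_cancel (Fact.out : p.Prime).one_le, (even_pred_of_odd hp).neg_one_pow, one_mul,
    Nat.descFactorial_self] at h1
  have h2 := hc 1
  rw [mul_one, h1, shiftedFactorial_zero_right] at h2
  rw [hc, shiftedFactorial_zero_right]
  linear_combination -t * h2

/-- Each block of length `p` contributes the same factor `-(p-1)!`, by
`shiftedFactorial_pred_prime_mul`. -/
lemma padicGammaNat_mul (hp : Odd p) (e : ℕ) :
    (padicGammaNat p (p * e) : ZMod (p ^ 2)) = (-((p - 1).factorial : ZMod (p ^ 2))) ^ e := by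
  have hpp : p.Prime := Fact.out
  induction e with
  | zero => simp [padicGammaNat]
  | succ e ih =>
    have h := congrArg (Int.cast : ℤ → ZMod (p ^ 2))
      (padicGammaNat_mul_add_one_add e (Nat.sub_lt hpp.pos one_pos))
    rw [show p * e + 1 + (p - 1) = p * (e + 1) by rw [mul_add]; have := hpp.one_le; omega,
      (even_pred_of_odd hp).neg_one_pow, Int.cast_mul, intCast_shiftedFactorial] at h
    push_cast at h
    rw [← mul_neg, shiftedFactorial_pred_prime_mul hp] at h
    rw [h, ih]
    ring

/-- By Wilson `-(p-1)! = 1 + ε` with `ε` a multiple of `p`, so its `n`-th power is `1 + n ε`, which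
depends only on `n` modulo `p`. -/
lemma neg_factorial_pow_eq_self {n : ℕ} (hn : n ≡ 1 [MOD p]) :
    (-((p - 1).factorial : ZMod (p ^ 2))) ^ n = -((p - 1).factorial : ZMod (p ^ 2)) := by
  have hw : ((((p - 1).factorial + 1 : ℕ) : ℤ) : ZMod p) = 0 := by
    push_cast
    rw [ZMod.wilsons_lemma]
    simp
  obtain ⟨z, hz⟩ := (ZMod.intCast_zmod_eq_zero_iff_dvd _ _).1 hw
  have hz' := congrArg (Int.cast : ℤ → ZMod (p ^ 2)) hz
  push_cast at hz'
  have hπ := natCast_prime_sq_eq_zero p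
  have hε : (-((p : ZMod (p ^ 2)) * z)) ^ 2 = 0 := by
    linear_combination (z : ZMod (p ^ 2)) ^ 2 * hπ
  have hn' : ((n : ℤ) - 1 : ℤ) = (p : ℤ) * (((n : ℤ) - 1) / p) := by
    refine (Int.mul_ediv_cancel' ?_).symm
    have := (Nat.modEq_iff_dvd.1 hn.symm)
    simpa using this
  have hn'' := congrArg (Int.cast : ℤ → ZMod (p ^ 2)) hn'
  push_cast at hn''
  rw [show -((p - 1).factorial : ZMod (p ^ 2)) = 1 + -((p : ZMod (p ^ 2)) * z) by
    linear_combination -hz', one_add_pow_of_sq_eq_zero hε]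
  generalize ((((n : ℤ) - 1) / p : ℤ) : ZMod (p ^ 2)) = s at hn''
  linear_combination (-((p : ZMod (p ^ 2)) * z)) * hn'' - s * z * hπ

/-- The value of `Γ_p(p / d - m) ^ d` modulo `p ^ 2`. -/
lemma padicGamma_pow_mul_shiftedFactorial_pow (hp : Odd p) {d e m : ℕ} (hm : m < p)
    (hde : (d : ZMod (p ^ 2)) * e = 1) {x : ℤ_[p]}
    (hx : PadicInt.toZModPow 2 x = (p : ZMod (p ^ 2)) * e - m) :
    PadicInt.toZModPow 2 (padicGamma p x) ^ d *
      shiftedFactorial m ((p : ZMod (p ^ 2)) * e) ^ d = -((p - 1).factorial : ZMod (p ^ 2)) := by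
  have hpp : p.Prime := Fact.out
  have : Fact (1 < p ^ 2) := ⟨Nat.one_lt_pow two_ne_zero hpp.one_lt⟩
  -- Positivity makes `p * e - m` a genuine natural number, usable as a representative of `x`.
  have he : 0 < e := by
    rcases Nat.eq_zero_or_pos e with rfl | h
    · simp at hde
    · exact h
  have hle : m ≤ p * e := hm.le.trans (Nat.le_mul_of_pos_right p he)
  have h1 := congrArg (Int.cast : ℤ → ZMod (p ^ 2))
    (padicGammaNat_sub_mul_shiftedFactorial he hm)
  rw [Int.cast_mul, intCast_shiftedFactorial, padicGammaNat_mul hp] at h1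
  push_cast at h1
  rw [toZModPow_padicGamma hp x (n := p * e - m) (by rw [hx, Nat.cast_sub hle, Nat.cast_mul]),
    ← mul_pow, h1, ← pow_mul]
  refine neg_factorial_pow_eq_self ?_
  have h2 : ((e * d : ℕ) : ZMod (p ^ 2)) = (1 : ℕ) := by
    push_cast
    rw [mul_comm, hde]
  exact ((ZMod.natCast_eq_natCast_iff _ _ _).1 h2).of_dvd (dvd_pow_self p two_ne_zero)

lemma sum_prod_ascPochhammer_mul (hp : Odd p) {ι : Type*} [Fintype ι] {e : ℕ}
    (hde : (Fintype.card ι : ZMod (p ^ 2)) * e = 1) {v : ℕ → ZMod (p ^ 2)}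
    (hv : ∀ k < p, v k * (k.factorial : ZMod (p ^ 2)) = 1) {n : ι → ℕ}
    (hn : ∑ i, n i + 1 = p) :
    (∑ k ∈ Finset.range p, v k ^ Fintype.card ι *
        ∏ i, (ascPochhammer (ZMod (p ^ 2)) k).eval ((n i : ZMod (p ^ 2)) + 1 - p * e)) *
      ∏ i, shiftedFactorial (n i) ((p : ZMod (p ^ 2)) * e) =
        ((p - 1).factorial : ZMod (p ^ 2)) := by
  have hp1 : p - 1 + 1 = p := Nat.sub_add_cancel (Fact.out : p.Prime).one_le
  have h := sum_prod_shiftedFactorial (R := ZMod (p ^ 2)) (even_pred_of_odd hp)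
    (by rw [hp1]; exact natCast_prime_sq_eq_zero p) hde v
    (fun k hk => hv k (by omega)) n (by omega)
  rw [hp1] at h
  rw [← h, Finset.sum_mul]
  refine Finset.sum_congr rfl fun k _ => ?_
  simp_rw [shiftedFactorial_add, Finset.prod_mul_distrib]
  ring

end ModSq

/-! ### Passage between `ℚ`, `ℤ_p` and `ZMod (p ^ 2)` -/

lemma map_eval_ascPochhammer {S T : Type*} [CommSemiring S] [CommSemiring T] (f : S →+* T) (k : ℕ)
    (z : S) : f ((ascPochhammer S k).eval z) = (ascPochhammer T k).eval (f z) := by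
  rw [← ascPochhammer_map f, Polynomial.eval_map, Polynomial.eval₂_at_apply]

lemma ratCast_poch {p : ℕ} [Fact p.Prime] {q : ℚ} {z : ℤ_[p]} (h : (q : ℚ_[p]) = z) (k : ℕ) :
    ((poch q k : ℚ) : ℚ_[p]) = ((ascPochhammer ℤ_[p] k).eval z : ℤ_[p]) := by
  have h1 := map_eval_ascPochhammer (algebraMap ℚ ℚ_[p]) k q
  have h2 := map_eval_ascPochhammer (PadicInt.Coe.ringHom (p := p)) k z
  simp only [eq_ratCast] at h1
  rw [poch, h1, h]
  exact h2.symm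

lemma padicModEq_of_toZModPow_eq {p : ℕ} [Fact p.Prime] {m : ℕ} {a b : ℤ_[p]}
    (h : PadicInt.toZModPow m a = PadicInt.toZModPow m b) :
    PadicModEq p m (a : ℚ_[p]) (b : ℚ_[p]) := by
  have hmem : a - b ∈ RingHom.ker (PadicInt.toZModPow m : ℤ_[p] →+* ZMod (p ^ m)) := by
    rw [RingHom.mem_ker, map_sub, h, sub_self]
  rw [PadicInt.ker_toZModPow, Ideal.mem_span_singleton] at hmem
  obtain ⟨z, hz⟩ := hmem
  refine ⟨z, ?_⟩
  rw [← PadicInt.coe_sub, hz]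
  push_cast
  rfl

lemma exists_padicInt_mul_natCast_eq_one {p : ℕ} [Fact p.Prime] {n : ℕ} (h : n.Coprime p) :
    ∃ v : ℤ_[p], v * (n : ℤ_[p]) = 1 := by
  have : IsUnit (n : ℤ_[p]) := PadicInt.isUnit_iff.2 (PadicInt.norm_natCast_eq_one_iff.2 h.symm)
  exact this.exists_left_inv

/-- The common setup: inverses of `d` and of the factorials in `ℤ_p`, and the reduction of `r / d`
modulo `p ^ 2`. -/
lemma exists_padicInt_data {p d r m : ℕ} [Fact p.Prime]
    (hgcd : Nat.gcd d r = 1) (hm : p + r = d * m) :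
    ∃ (D : ℤ_[p]) (e : ℕ) (V : ℕ → ℤ_[p]), D * (d : ℤ_[p]) = 1 ∧
      (d : ZMod (p ^ 2)) * e = 1 ∧
      PadicInt.toZModPow 2 ((r : ℤ_[p]) * D) = (m : ZMod (p ^ 2)) - p * e ∧
      ∀ k < p, V k * (k.factorial : ℤ_[p]) = 1 := by
  have hpp : p.Prime := Fact.out
  -- If `p ∣ d`, then `p + r = d * m` forces `p ∣ r`, against `gcd d r = 1`.
  have hcop : d.Coprime p := by
    rw [Nat.coprime_comm, hpp.coprime_iff_not_dvd]
    intro h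
    have h1 : p ∣ r := (Nat.dvd_add_right dvd_rfl).1 (hm ▸ h.mul_right m)
    exact hpp.one_lt.ne' (Nat.dvd_one.1 (hgcd ▸ Nat.dvd_gcd h h1))
  obtain ⟨D, hD⟩ := exists_padicInt_mul_natCast_eq_one hcop
  have hV : ∀ k : ℕ, ∃ v : ℤ_[p], k < p → v * (k.factorial : ℤ_[p]) = 1 := fun k => by
    by_cases hk : k < p
    · obtain ⟨v, hv⟩ := exists_padicInt_mul_natCast_eq_one
        ((hpp.coprime_factorial_of_lt hk).symm)
      exact ⟨v, fun _ => hv⟩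
    · exact ⟨0, fun h => absurd h hk⟩
  choose V hV using hV
  have : NeZero (p ^ 2) := ⟨pow_ne_zero _ hpp.ne_zero⟩
  have hφ : PadicInt.toZModPow 2 D = (((PadicInt.toZModPow 2 D).val : ℕ) : ZMod (p ^ 2)) := by simp
  have hDd := congrArg (PadicInt.toZModPow 2) hD
  rw [map_mul, map_natCast, map_one] at hDd
  refine ⟨D, (PadicInt.toZModPow 2 D).val, V, hD, ?_, ?_, hV⟩
  · rw [← hφ, mul_comm, hDd]
  · rw [← hφ, map_mul, map_natCast]
    have h := congrArg (Nat.cast : ℕ → ZMod (p ^ 2)) hm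
    push_cast at h
    linear_combination PadicInt.toZModPow 2 D * h + (m : ZMod (p ^ 2)) * hDd

lemma exists_eq_mul_of_modEq_neg {p d r : ℕ} (hp : 5 ≤ p) (hr : 0 < r) (hdr : r < d)
    (h : (p : ℤ) ≡ -(r : ℤ) [ZMOD (d : ℤ)]) : ∃ m, p + r = d * (m + 1) ∧ m + 1 < p := by
  have h1 : (d : ℤ) ∣ ((p + r : ℕ) : ℤ) := by
    have := h.symm.dvd
    push_cast
    simpa using this
  obtain ⟨m, hm⟩ := Int.natCast_dvd_natCast.1 h1
  rcases m with _ | m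
  · omega
  · refine ⟨m, hm, ?_⟩
    have h2 : 2 * m ≤ d * m := Nat.mul_le_mul_right m (by omega)
    rw [mul_add] at hm
    omega

/-! ### The two congruences -/

section Congruences

variable {p d r : ℕ} [Fact p.Prime] {D : ℤ_[p]} {e : ℕ} {V : ℕ → ℤ_[p]}

lemma ratCast_factorial_pow_inv (hV : ∀ k < p, V k * (k.factorial : ℤ_[p]) = 1) {k : ℕ}
    (hk : k < p) (d : ℕ) :
    ((((k.factorial : ℚ) ^ d)⁻¹ : ℚ) : ℚ_[p]) = ((V k ^ d : ℤ_[p]) : ℚ_[p]) := by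
  have h := congrArg (fun z : ℤ_[p] => (z : ℚ_[p])) (hV k hk)
  push_cast at h
  push_cast
  rw [← inv_pow, inv_eq_of_mul_eq_one_left h]

lemma natCast_div_eq (hd : d ≠ 0) (hD : D * (d : ℤ_[p]) = 1) :
    (r : ℚ_[p]) / d = (((r : ℤ_[p]) * D : ℤ_[p]) : ℚ_[p]) := by
  have h := congrArg (fun z : ℤ_[p] => (z : ℚ_[p])) hD
  push_cast at h
  have hd' : (d : ℚ_[p]) ≠ 0 := Nat.cast_ne_zero.2 hd
  rw [div_eq_iff hd']
  push_cast
  linear_combination -(r : ℚ_[p]) * h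

lemma isUnit_toZModPow_factorial (hV : ∀ k < p, V k * (k.factorial : ℤ_[p]) = 1) :
    IsUnit ((p - 1).factorial : ZMod (p ^ 2)) := by
  have h := congrArg (PadicInt.toZModPow 2)
    (hV (p - 1) (Nat.sub_lt (Fact.out : p.Prime).pos one_pos))
  rw [map_mul, map_natCast, map_one] at h
  exact IsUnit.of_mul_eq_one_right _ h

lemma toZModPow_factorial_inv (hV : ∀ k < p, V k * (k.factorial : ℤ_[p]) = 1) :
    ∀ k < p, PadicInt.toZModPow 2 (V k) * (k.factorial : ZMod (p ^ 2)) = 1 := fun k hk => by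
  simpa using congrArg (PadicInt.toZModPow 2) (hV k hk)

lemma toZModPow_sum_two_types (hp : Odd p) {m : ℕ} (hm : p + r = d * (m + 1)) (hmp : m + 1 < p)
    (hdr : r < d) (hde : (d : ZMod (p ^ 2)) * e = 1) {z : ℤ_[p]}
    (hz : PadicInt.toZModPow 2 z = ((m + 1 : ℕ) : ZMod (p ^ 2)) - p * e)
    (hV : ∀ k < p, V k * (k.factorial : ℤ_[p]) = 1) :
    PadicInt.toZModPow 2 (∑ k ∈ Finset.range p,
      (ascPochhammer ℤ_[p] k).eval (z + 1) ^ (d - r - 1) *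
        (ascPochhammer ℤ_[p] k).eval z ^ (r + 1) * V k ^ d) =
    PadicInt.toZModPow 2 (-(z ^ (r + 1)) * padicGamma p (-z) ^ d) := by
  obtain ⟨s, rfl⟩ : ∃ s, d = s + (r + 1) := ⟨d - r - 1, by omega⟩
  have hcard : Fintype.card (Fin s ⊕ Fin (r + 1)) = s + (r + 1) := by simp
  have hS := sum_prod_ascPochhammer_mul (ι := Fin s ⊕ Fin (r + 1)) hp
    (by rw [hcard]; exact hde) (toZModPow_factorial_inv hV)
    -- An index `n` produces the parameter `n + 1 - p/d`: thus `m + 1` stands for `z + 1` and `m`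
    -- for `z`.
    (n := Sum.elim (fun _ => m + 1) (fun _ => m))
    (by simp only [Fintype.sum_sum_type, Sum.elim_inl, Sum.elim_inr, Finset.sum_const,
          Finset.card_univ, Fintype.card_fin, smul_eq_mul]
        linarith)
  have hG := padicGamma_pow_mul_shiftedFactorial_pow hp hmp hde (x := -z)
    (by rw [map_neg, hz]; ring)
  rw [hcard] at hS
  simp only [Fintype.prod_sum_type, Sum.elim_inl, Sum.elim_inr, Finset.prod_const,
    Finset.card_univ, Fintype.card_fin] at hS
  have hu := isUnit_toZModPow_factorial hV
  rw [← hS] at hu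
  -- The product of shifted factorials divides the unit `(p-1)!`, so it may be cancelled.
  refine (isUnit_of_mul_isUnit_right hu).mul_right_cancel ?_
  simp only [map_sum, map_mul, map_pow, map_neg, map_eval_ascPochhammer, map_add, map_one, hz]
  refine Eq.trans (Eq.trans (congrArg (· * _) (Finset.sum_congr rfl fun k _ => ?_)) hS) ?_
  · rw [show s + (r + 1) - r - 1 = s by omega, sub_add_eq_add_sub, mul_comm]
    push_cast
    rfl
  -- The last factor of `F(m + 1, p/d)` is `z`, so `z ^ (r + 1)` completes the product to `F(m + 1,
  -- p/d) ^ d`.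
  · rw [shiftedFactorial_succ] at hG ⊢
    rw [mul_pow] at hG
    simp only [mul_pow]
    push_cast
    linear_combination hG

lemma toZModPow_sum_three_types (hp : Odd p) {m : ℕ} (hm : p + r = d * (m + 2)) (hmp : m + 2 < p)
    (hr : 0 < r) (hdr : r < d) (hde : (d : ZMod (p ^ 2)) * e = 1) {z : ℤ_[p]}
    (hz : PadicInt.toZModPow 2 z = ((m + 2 : ℕ) : ZMod (p ^ 2)) - p * e)
    (hV : ∀ k < p, V k * (k.factorial : ℤ_[p]) = 1) :
    PadicInt.toZModPow 2 (∑ k ∈ Finset.range p,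
      (ascPochhammer ℤ_[p] k).eval (z + 1) ^ (d - r) *
        (ascPochhammer ℤ_[p] k).eval z ^ (r - 1) *
          (ascPochhammer ℤ_[p] k).eval (z - 1) * V k ^ d) =
    PadicInt.toZModPow 2 ((1 - z) * z ^ r * padicGamma p (-z) ^ d) := by
  obtain ⟨t, rfl⟩ : ∃ t, r = t + 1 := ⟨r - 1, by omega⟩
  obtain ⟨s, rfl⟩ : ∃ s, d = s + (t + 1) := ⟨d - (t + 1), by omega⟩
  have hcard : Fintype.card (Fin s ⊕ Fin t ⊕ Unit) = s + (t + 1) := by simp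
  have hS := sum_prod_ascPochhammer_mul (ι := Fin s ⊕ Fin t ⊕ Unit) hp
    (by rw [hcard]; exact hde) (toZModPow_factorial_inv hV)
    (n := Sum.elim (fun _ => m + 2) (Sum.elim (fun _ => m + 1) (fun _ => m)))
    (by simp only [Fintype.sum_sum_type, Sum.elim_inl, Sum.elim_inr, Finset.sum_const,
          Finset.card_univ, Fintype.card_fin, Fintype.card_unit, smul_eq_mul]
        linarith)
  have hG := padicGamma_pow_mul_shiftedFactorial_pow hp hmp hde (x := -z)
    (by rw [map_neg, hz]; ring)
  rw [hcard] at hS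
  simp only [Fintype.prod_sum_type, Sum.elim_inl, Sum.elim_inr, Finset.prod_const,
    Finset.card_univ, Fintype.card_fin, Fintype.card_unit, pow_one] at hS
  have hu := isUnit_toZModPow_factorial hV
  rw [← hS] at hu
  refine (isUnit_of_mul_isUnit_right hu).mul_right_cancel ?_
  simp only [map_sum, map_mul, map_pow, map_eval_ascPochhammer, map_add, map_sub,
    map_one, hz]
  refine Eq.trans (Eq.trans (congrArg (· * _) (Finset.sum_congr rfl fun k _ => ?_)) hS) ?_
  · rw [Nat.add_sub_cancel, Nat.add_sub_cancel, mul_comm, mul_assoc]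
    have h1 : ((m + 2 : ℕ) : ZMod (p ^ 2)) - p * e + 1 = ((m + 2 : ℕ) : ZMod (p ^ 2)) + 1 - p * e := by
      ring
    have h2 : ((m + 2 : ℕ) : ZMod (p ^ 2)) - p * e = ((m + 1 : ℕ) : ZMod (p ^ 2)) + 1 - p * e := by
      push_cast
      ring
    have h3 : ((m + 1 : ℕ) : ZMod (p ^ 2)) + 1 - p * e - 1 = (m : ZMod (p ^ 2)) + 1 - p * e := by
      push_cast
      ring
    rw [h1, h2, h3]
  -- The last two factors of `F(m + 2, p/d)` are `z - 1` and `z`; hence `(1 - z) * z ^ r` completes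
  -- the product to `-F(m + 2, p/d) ^ d`.
  · rw [shiftedFactorial_succ] at hG ⊢
    rw [shiftedFactorial_succ] at hG ⊢
    push_cast at hG ⊢
    rw [mul_pow, mul_pow] at hG
    simp only [mul_pow]
    linear_combination hG

end Congruences

theorem corollary4p3 :
    (∀ (d r p : ℕ) [Fact p.Prime], 0 < r → d ≥ 3 + r → Nat.gcd d r = 1 →
      (p : ℤ) ≥ 2 * (d : ℤ) - (r : ℤ) → (p : ℤ) ≡ -(r : ℤ) [ZMOD (d : ℤ)] →
      ∃ x : ℤ_[p], (x : ℚ_[p]) = -((r : ℚ_[p]) / (d : ℚ_[p])) ∧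
        PadicModEq p 2
          ((∑ k ∈ Finset.range p,
            poch (((d : ℚ) + r) / d) k ^ (d - r) * poch ((r : ℚ) / d) k ^ (r - 1) *
              poch (((r : ℚ) - d) / d) k / (k.factorial : ℚ) ^ d : ℚ) : ℚ_[p])
          (((d : ℚ_[p]) - r) / d * ((r : ℚ_[p]) / d) ^ r * (padicGamma p x : ℚ_[p]) ^ d)) ∧
    (∀ (d r p : ℕ) [Fact p.Prime], 0 < r → d > r → Nat.gcd d r = 1 →
      p ≥ 5 → (p : ℤ) ≡ -(r : ℤ) [ZMOD (d : ℤ)] →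
      ∃ x : ℤ_[p], (x : ℚ_[p]) = -((r : ℚ_[p]) / (d : ℚ_[p])) ∧
        PadicModEq p 2
          ((∑ k ∈ Finset.range p,
            poch (((d : ℚ) + r) / d) k ^ (d - r - 1) * poch ((r : ℚ) / d) k ^ (r + 1)
              / (k.factorial : ℚ) ^ d : ℚ) : ℚ_[p])
          (-(((r : ℚ_[p]) / d) ^ (r + 1)) * (padicGamma p x : ℚ_[p]) ^ d)) := by
  constructor
  · intro d r p _ hr hd hgcd hp hmod
    have hp5 : 5 ≤ p := by omega
    have hodd : Odd p := (Fact.out : p.Prime).odd_of_ne_two (by omega)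
    obtain ⟨m, hm, hmp⟩ := exists_eq_mul_of_modEq_neg hp5 hr (by omega) hmod
    -- The bound `p ≥ 2d - r` says `(p + r)/d ≥ 2`, so the index belonging to `(r - d)/d` is a
    -- natural number.
    obtain ⟨m, rfl⟩ : ∃ m', m = m' + 1 := by
      refine ⟨m - 1, (Nat.sub_add_cancel (Nat.pos_of_ne_zero ?_)).symm⟩
      rintro rfl
      omega
    obtain ⟨D, e, V, hD, hde, hz, hV⟩ := exists_padicInt_data hgcd hm
    have hrd := natCast_div_eq (r := r) (by omega) hD
    have hd0 : (d : ℚ) ≠ 0 := Nat.cast_ne_zero.2 (by omega)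
    have hd0' : (d : ℚ_[p]) ≠ 0 := Nat.cast_ne_zero.2 (by omega)
    have hB : (((r : ℚ) / d : ℚ) : ℚ_[p]) = ((r : ℤ_[p]) * D : ℤ_[p]) := by
      rw [← hrd]; push_cast; rfl
    have hA : ((((d : ℚ) + r) / d : ℚ) : ℚ_[p]) = ((r : ℤ_[p]) * D + 1 : ℤ_[p]) := by
      rw [add_div, div_self hd0, Rat.cast_add, hB]; push_cast; ring
    have hC : ((((r : ℚ) - d) / d : ℚ) : ℚ_[p]) = ((r : ℤ_[p]) * D - 1 : ℤ_[p]) := by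
      rw [sub_div, div_self hd0, Rat.cast_sub, hB]; push_cast; ring
    refine ⟨-(r * D), by rw [hrd]; push_cast; ring, ?_⟩
    have h := padicModEq_of_toZModPow_eq
      (toZModPow_sum_three_types hodd hm hmp hr (by omega) hde hz hV)
    convert h using 1
    · rw [Rat.cast_sum, PadicInt.coe_sum]
      refine Finset.sum_congr rfl fun k hk => ?_
      rw [div_eq_mul_inv, Rat.cast_mul, ratCast_factorial_pow_inv hV (Finset.mem_range.1 hk)]
      push_cast
      rw [ratCast_poch hA, ratCast_poch hB, ratCast_poch hC]
    · rw [sub_div, div_self hd0', hrd]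
      push_cast
      rfl
  · intro d r p _ hr hd hgcd hp hmod
    have hodd : Odd p := (Fact.out : p.Prime).odd_of_ne_two (by omega)
    obtain ⟨m, hm, hmp⟩ := exists_eq_mul_of_modEq_neg hp hr hd hmod
    obtain ⟨D, e, V, hD, hde, hz, hV⟩ := exists_padicInt_data hgcd hm
    have hrd := natCast_div_eq (r := r) (by omega) hD
    have hd0 : (d : ℚ) ≠ 0 := Nat.cast_ne_zero.2 (by omega)
    have hB : (((r : ℚ) / d : ℚ) : ℚ_[p]) = ((r : ℤ_[p]) * D : ℤ_[p]) := by
      rw [← hrd]; push_cast; rfl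
    have hA : ((((d : ℚ) + r) / d : ℚ) : ℚ_[p]) = ((r : ℤ_[p]) * D + 1 : ℤ_[p]) := by
      rw [add_div, div_self hd0, Rat.cast_add, hB]; push_cast; ring
    refine ⟨-(r * D), by rw [hrd]; push_cast; ring, ?_⟩
    have h := padicModEq_of_toZModPow_eq
      (toZModPow_sum_two_types hodd hm hmp hd hde hz hV)
    convert h using 1
    · rw [Rat.cast_sum, PadicInt.coe_sum]
      refine Finset.sum_congr rfl fun k hk => ?_
      rw [div_eq_mul_inv, Rat.cast_mul, ratCast_factorial_pow_inv hV (Finset.mem_range.1 hk)]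
      push_cast
      rw [ratCast_poch hA, ratCast_poch hB]
    · rw [hrd]
      push_cast
      rfl
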